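/- Conventions. A finitely generated group is identified with its Cayley graph for a finite generating set (vertices $u \neq v$ are adjacent iff $u^{-1}v$ or $v^{-1}u$ is a generator) and carries the path metric $d$; the generating sets may be chosen arbitrarily. A map $f\colon X\to Y$ is a $(C,K)$-quasi-isometry ($C\ge 1$, $K\ge 0$) if $\frac1C d(x,y)-K\le d(f(x),f(y))\le C\,d(x,y)+K$ for all $x,y\in X$ and every $y \in Y$ is at distance at most $K$ from $f(X)$; it is a quasi-isometry if this holds for some $C,K$, and a biLipschitz equivalence if this holds for some $C$ with $K=0$. A quasi-inverse of $f$ is a map $g\colon Y\to X$ such that $g\circ f$ and $f\circ g$ are at bounded distance from the identity maps. For $k>0$, a quasi-isometry $f\colon X\to Y$ is quasi-$k$-to-one if there is $C>0$ such that $\bigl|k|A|-|f^{-1}(A)|\bigr|\le C\,|\partial A|$ for every finite $A\subset Y$, where $\partial A$ is the set of vertices of $Y\setminus A$ adjacent to a vertex of $A$. For groups $N,G$, let $N^{(G)}=\bigoplus_G N$ be the group of finitely supported maps $G\to N$, and $N\wr G=N^{(G)}\rtimes G$, where $G$ acts on $N^{(G)}$ through left multiplication on itself. A quasi-isometry $q\colon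 N\wr G\to M\wr H$ is of aptolic form if there are maps $\alpha\colon N^{(G)}\to M^{(H)}$ and $\beta\colon G\to H$ with $q(c,p)=(\alpha(c),\beta(p))$ for all $(c,p)\in N\wr G$; it is aptolic if it is of aptolic form and has a quasi-inverse of aptolic form. Proposition. Let $N,M,G,H$ be finitely generated groups and let $n,m\ge 2$ be integers. If $G$ is finite, assume moreover that $m$ divides $|G|$. If there exist a biLipschitz equivalence $N^m\to M^n$ and a quasi-$\frac mn$-to-one quasi-isometry $G\to H$, then there exists an aptolic quasi-isometry $N\wr G\to M\wr H$. -/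

import Mathlib

namespace CoarseWreath

section Coarse

variable {V W : Type*}

/-- `f` is a `(C, K)`-quasi-isometry between the vertex sets of the graphs `X` and `Y`, endowed with
their path metrics `X.dist` and `Y.dist`. -/
def IsQuasiIsometryWith (C K : ℝ) (X : SimpleGraph V) (Y : SimpleGraph W) (f : V → W) : Prop :=
  (∀ x y : V, 1 / C * (X.dist x y : ℝ) - K ≤ (Y.dist (f x) (f y) : ℝ) ∧
    (Y.dist (f x) (f y) : ℝ) ≤ C * (X.dist x y : ℝ) + K) ∧
  ∀ y : W, ∃ x : V, (Y.dist y (f x) : ℝ) ≤ K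

/-- `f` is a quasi-isometry: a `(C, K)`-quasi-isometry for some `C ≥ 1` and `K ≥ 0`. -/
def IsQuasiIsometry (X : SimpleGraph V) (Y : SimpleGraph W) (f : V → W) : Prop :=
  ∃ C K : ℝ, 1 ≤ C ∧ 0 ≤ K ∧ IsQuasiIsometryWith C K X Y f

/-- `f` is a biLipschitz equivalence: a `(C, 0)`-quasi-isometry for some `C ≥ 1`. -/
def IsBiLipschitzEquivalence (X : SimpleGraph V) (Y : SimpleGraph W) (f : V → W) : Prop :=
  ∃ C : ℝ, 1 ≤ C ∧ IsQuasiIsometryWith C 0 X Y f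

/-- `g` is a quasi-inverse of `f`: both `g ∘ f` and `f ∘ g` are at bounded distance from the
identity. -/
def IsQuasiInverse (X : SimpleGraph V) (Y : SimpleGraph W) (f : V → W) (g : W → V) : Prop :=
  ∃ K : ℝ, (∀ x : V, (X.dist (g (f x)) x : ℝ) ≤ K) ∧ ∀ y : W, (Y.dist (f (g y)) y : ℝ) ≤ K

/-- The boundary of `A` in the graph `Y`: the vertices outside `A` adjacent to a vertex of `A`. -/
def vertexBoundary (Y : SimpleGraph W) (A : Set W) : Set W :=
  {y | y ∉ A ∧ ∃ x ∈ A, Y.Adj x y}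

/-- `f` is a quasi-`k`-to-one quasi-isometry. The graphs are meant to have bounded degree, in which
case the preimage and the boundary below are finite. -/
def IsQuasiToOne (k : ℝ) (X : SimpleGraph V) (Y : SimpleGraph W) (f : V → W) : Prop :=
  IsQuasiIsometry X Y f ∧ 0 < k ∧
    ∃ C : ℝ, 0 < C ∧ ∀ A : Finset W,
      |k * (A.card : ℝ) - ((f ⁻¹' (A : Set W)).ncard : ℝ)| ≤
        C * ((vertexBoundary Y (A : Set W)).ncard : ℝ)

end Coarse

section Wreath

/-- The group `N^(G)` of finitely supported colourings `G → N`, i.e. the direct sum of copies of `N`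
indexed by `G`, with pointwise multiplication. -/
def Colouring (N G : Type*) [Group N] : Subgroup (G → N) where
  carrier := {c | (Function.mulSupport c).Finite}
  one_mem' := by simp
  mul_mem' {c d} hc hd := (Set.Finite.union hc hd).subset (Function.mulSupport_mul c d)
  inv_mem' {c} hc := by simpa using hc

/-- The action of `G` on colourings induced by left multiplication of `G` on itself:
`(g • c) x = c (g⁻¹ * x)`. -/
def colouringAction (N G : Type*) [Group N] [Group G] : G →* MulAut (Colouring N G) where
  toFun g :=
    { toFun := fun c => ⟨fun x => c.1 (g⁻¹ * x), by
        have h : (Function.mulSupport c.1).Finite := c.2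
        exact h.preimage (mul_right_injective g⁻¹).injOn⟩
      invFun := fun c => ⟨fun x => c.1 (g * x), by
        have h : (Function.mulSupport c.1).Finite := c.2
        exact h.preimage (mul_right_injective g).injOn⟩
      left_inv := fun c => by ext x; simp
      right_inv := fun c => by ext x; simp
      map_mul' := fun c d => by ext x; simp }
  map_one' := by ext c x; simp
  map_mul' g h := by ext c x; simp [mul_assoc]

/-- The (restricted, standard) wreath product `N ≀ G`: pairs of a colouring in `N^(G)` (the field
`left`) and an element of `G` (the field `right`). -/
abbrev Wreath (N G : Type*) [Group N] [Group G] : Type _ :=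
  Colouring N G ⋊[colouringAction N G] G

/-- The colouring with value `a` at `p` and trivial elsewhere. -/
noncomputable def Colouring.single {N G : Type*} [Group N] (p : G) (a : N) : Colouring N G :=
  open Classical in
  ⟨Pi.mulSingle p a, (Set.finite_singleton p).subset Pi.mulSupport_mulSingle_subset⟩

/-- If `T` generates `N` and `S` generates `G`, then the elements `(δ_a, 1)`, `a ∈ T`, and `(1, s)`,
`s ∈ S`, generate `N ≀ G`. -/
theorem closure_standard_generators {N G : Type*} [Group N] [Group G] {T : Set N} {S : Set G}
    (hT : Subgroup.closure T = ⊤) (hS : Subgroup.closure S = ⊤) :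
    Subgroup.closure
      (((fun a => (SemidirectProduct.inl (Colouring.single 1 a) : Wreath N G)) '' T) ∪
        ((fun s => (SemidirectProduct.inr s : Wreath N G)) '' S)) = ⊤ := by
  classical
  set K : Subgroup (Wreath N G) := Subgroup.closure _ with hK
  have h1 : ∀ s : G, (SemidirectProduct.inr s : Wreath N G) ∈ K := by
    have : (⊤ : Subgroup G) ≤ K.comap SemidirectProduct.inr := by
      rw [← hS, Subgroup.closure_le]
      exact fun s hs => Subgroup.subset_closure (Or.inr ⟨s, hs, rfl⟩)
    exact fun s => this (Subgroup.mem_top s)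
  let σ : N →* Colouring N G :=
    { toFun := Colouring.single 1
      map_one' := Subtype.ext (Pi.mulSingle_one (M := fun _ : G => N) 1)
      map_mul' := fun a b => Subtype.ext (Pi.mulSingle_mul (f := fun _ : G => N) 1 a b) }
  have h2 : ∀ a : N, (SemidirectProduct.inl (Colouring.single 1 a) : Wreath N G) ∈ K := by
    have : (⊤ : Subgroup N) ≤ K.comap
        ((SemidirectProduct.inl : Colouring N G →* Wreath N G).comp σ) := by
      rw [← hT, Subgroup.closure_le]
      exact fun a ha => Subgroup.subset_closure (Or.inl ⟨a, ha, rfl⟩)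
    exact fun a => this (Subgroup.mem_top a)
  have h3 : ∀ (p : G) (a : N),
      (SemidirectProduct.inl (Colouring.single p a) : Wreath N G) ∈ K := by
    intro p a
    have : (Colouring.single p a : Colouring N G) =
        colouringAction N G p (Colouring.single 1 a) := by
      ext x
      simp only [Colouring.single, colouringAction, MonoidHom.coe_mk, OneHom.coe_mk,
        MulEquiv.coe_mk, Equiv.coe_fn_mk, Pi.mulSingle_apply]
      congr 1
      rw [eq_iff_iff, inv_mul_eq_one, eq_comm]
    rw [this, SemidirectProduct.inl_aut]
    exact K.mul_mem (K.mul_mem (h1 _) (h2 _)) (h1 _)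
  have h4 : ∀ (F : Finset G) (c : Colouring N G), Function.mulSupport c.1 ⊆ F →
      (SemidirectProduct.inl c : Wreath N G) ∈ K := by
    intro F
    induction F using Finset.induction_on with
    | empty =>
      intro c hc
      have : c = 1 := by
        ext x
        by_contra h
        exact absurd (hc h) (by simp)
      rw [this, map_one]
      exact K.one_mem
    | insert p F hp ih =>
      intro c hc
      have : c = Colouring.single p (c.1 p) * ((Colouring.single p (c.1 p))⁻¹ * c) := by
        simp
      rw [this, map_mul]
      refine K.mul_mem (h3 _ _) (ih _ ?_)
      intro x hx
      by_cases hxp : x = p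
      · subst hxp
        exact absurd (by simp [Colouring.single]) hx
      · have : x ∈ Function.mulSupport c.1 := by
          simpa [Colouring.single, Pi.mulSingle_apply, hxp] using hx
        simpa [hxp] using hc this
  rw [eq_top_iff]
  intro w _
  rw [← SemidirectProduct.inl_left_mul_inr_right w]
  have hw : (Function.mulSupport w.left.1).Finite := w.left.2
  exact K.mul_mem (h4 hw.toFinset _ (by simp)) (h1 _)

/-- The wreath product of finitely generated groups is finitely generated. -/
instance wreath_fg {N G : Type*} [Group N] [Group G] [Group.FG N] [Group.FG G] :
    Group.FG (Wreath N G) := by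
  obtain ⟨T, hT, hTf⟩ := Group.fg_iff.1 ‹Group.FG N›
  obtain ⟨S, hS, hSf⟩ := Group.fg_iff.1 ‹Group.FG G›
  exact Group.fg_iff.2 ⟨_, closure_standard_generators hT hS, (hTf.image _).union (hSf.image _)⟩

variable {N M G H : Type*} [Group N] [Group M] [Group G] [Group H]

/-- `q : N ≀ G → M ≀ H` is of aptolic form: `q (c, p) = (α c, β p)` for some maps
`α : N^(G) → M^(H)` and `β : G → H`. -/
def IsOfAptolicForm (q : Wreath N G → Wreath M H) : Prop :=
  ∃ (α : Colouring N G → Colouring M H) (β : G → H),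
    ∀ (c : Colouring N G) (p : G), q ⟨c, p⟩ = ⟨α c, β p⟩

/-- `q` is an aptolic quasi-isometry: a quasi-isometry of aptolic form having a quasi-inverse (again
a quasi-isometry) of aptolic form. -/
def IsAptolicQuasiIsometry (X : SimpleGraph (Wreath N G)) (Y : SimpleGraph (Wreath M H))
    (q : Wreath N G → Wreath M H) : Prop :=
  IsQuasiIsometry X Y q ∧ IsOfAptolicForm q ∧
    ∃ r : Wreath M H → Wreath N G,
      IsQuasiIsometry Y X r ∧ IsQuasiInverse X Y q r ∧ IsOfAptolicForm r

end Wreath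

/-- `S` is a finite generating set of the group `G`. -/
def IsFiniteGeneratingSet {G : Type*} [Group G] (S : Set G) : Prop :=
  S.Finite ∧ Subgroup.closure S = ⊤

end CoarseWreath

open CoarseWreath

/-! Suppose G is cut into blocks of size m and H into blocks of size n, both indexed by one set I,
so that h stays at bounded distance from f(p) whenever p and h lie in blocks of equal index. After a
translation, the biLipschitz map is a bijection σ : N^m → M^n with σ(1) = 1. Applying σ block by
block gives a bijection α from N^(G) to M^(H). Then (c, p) ↦ (α(c), f(p)) is the required map:
recolouring p alters α(c) only on one block, near f(p), and by boundedly many values; moving p does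
not affect α(c). The inverse of α and a coarse inverse of f give the quasi-inverse in the same way
(`isControlled_blockMap`).

The blocks come from a weight t on H whose mass on each finite A is |A|/n up to a multiple of |∂A|.
Let I contain t(v) points placed at each v. Then I × n has about as many points in A as H, and I × m
about (m/n)|A|, which is about |f⁻¹(A)|. Families with such equal counts are matched at bounded
distance (`exists_equiv_dist_le`) by Hall's theorem, whose condition follows from a pigeonhole over
concentric annuli, with no case distinction on amenability.

For infinite H the weight comes from a flow on a spanning tree (`exists_isWeight_of_infinite`): each
vertex groups its own unit and what its children send into packets of n, and sends the remainder to
its parent. For finite H all the mass sits at one vertex, and m ∣ |G| makes |H|/n an integer. -/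

open CoarseWreath

namespace CoarseWreath

/-! ### Word metrics: invariance and finite balls. -/

section Cayley

open SimpleGraph

variable {G : Type*} [Group G]

theorem mulCayley_connected {S : Set G} (hS : Subgroup.closure S = ⊤) :
    (mulCayley S).Connected := by
  let K : Subgroup G :=
    { carrier := {g | ∀ w, (mulCayley S).Reachable w (w * g)}
      one_mem' := fun w => by simp
      mul_mem' := fun {a b} ha hb w => by
        rw [← mul_assoc]
        exact (ha w).trans (hb (w * a))
      inv_mem' := fun {a} ha w => by simpa using (ha (w * a⁻¹)).symm }
  have hK : K = ⊤ := by
    rw [eq_top_iff, ← hS, Subgroup.closure_le]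
    intro s hs w
    by_cases h : w = w * s
    · rw [← h]
    · exact SimpleGraph.Adj.reachable ((mulCayley_adj _ _ _).2 ⟨h, Or.inl (by simpa)⟩)
  refine ⟨fun u v => ?_⟩
  have : u⁻¹ * v ∈ K := hK ▸ Subgroup.mem_top _
  simpa using this u

theorem mulCayley_dist_mul_left {S : Set G} (hS : Subgroup.closure S = ⊤) (a u v : G) :
    (mulCayley S).dist (a * u) (a * v) = (mulCayley S).dist u v := by
  have key : ∀ a u v : G, (mulCayley S).dist (a * u) (a * v) ≤ (mulCayley S).dist u v := by
    intro a u v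
    obtain ⟨p, hp⟩ := (mulCayley_connected hS).exists_walk_length_eq_dist u v
    let φ : mulCayley S →g mulCayley S := ⟨fun x => a * x, fun h => by simpa using h⟩
    rw [← hp, ← Walk.length_map φ]
    exact dist_le (p.map φ)
  refine le_antisymm (key a u v) ?_
  simpa using key a⁻¹ (a * u) (a * v)

theorem mulCayley_dist_eq {S : Set G} (hS : Subgroup.closure S = ⊤) (u v : G) :
    (mulCayley S).dist u v = (mulCayley S).dist 1 (u⁻¹ * v) := by
  simpa using (mulCayley_dist_mul_left hS u⁻¹ u v).symm

theorem finite_ball_one {S : Set G} (hS : IsFiniteGeneratingSet S) (r : ℕ) :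
    {g : G | (mulCayley S).dist 1 g ≤ r}.Finite := by
  have key : ∀ r : ℕ, ∃ F : Set G, F.Finite ∧ ∀ (u v : G) (p : (mulCayley S).Walk u v),
      p.length ≤ r → u⁻¹ * v ∈ F := by
    intro r
    induction r with
    | zero =>
      refine ⟨{1}, Set.finite_singleton 1, fun u v p hp => ?_⟩
      cases p with
      | nil => simp
      | cons h q => simp at hp
    | succ r ih =>
      obtain ⟨F, hF, hr⟩ := ih
      refine ⟨{1} ∪ Set.image2 (· * ·) (S ∪ S⁻¹) F,
        (Set.finite_singleton 1).union ((hS.1.union hS.1.inv).image2 _ hF), fun u v p hp => ?_⟩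
      cases p with
      | nil => simp
      | @cons _ w _ h q =>
        refine Or.inr ⟨u⁻¹ * w, ?_, w⁻¹ * v, hr _ _ q (by simpa using hp), by group⟩
        rcases (mulCayley_adj _ _ _).1 h with ⟨-, h | h⟩
        · exact Or.inl h
        · exact Or.inr (by simpa using h)
  obtain ⟨F, hF, h⟩ := key r
  refine hF.subset fun g hg => ?_
  obtain ⟨p, hp⟩ := (mulCayley_connected hS.2).exists_walk_length_eq_dist 1 g
  simpa using h 1 g p (hp ▸ hg)

theorem exists_dist_le_of_finite (S : Set G) {F : Set G} (hF : F.Finite) :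
    ∃ L : ℕ, ∀ g ∈ F, (mulCayley S).dist 1 g ≤ L := by
  obtain ⟨L, hL⟩ := (hF.image ((mulCayley S).dist 1)).bddAbove
  exact ⟨L, fun g hg => hL ⟨g, hg, rfl⟩⟩

theorem ball_eq_image {S : Set G} (hS : Subgroup.closure S = ⊤) (r : ℕ) (x : G) :
    {y : G | (mulCayley S).dist x y ≤ r} =
      (fun y => x * y) '' {y : G | (mulCayley S).dist 1 y ≤ r} := by
  ext y
  simp only [Set.mem_ofPred_eq, Set.mem_image]
  constructor
  · intro h
    exact ⟨x⁻¹ * y, by rwa [← mulCayley_dist_eq hS], by simp⟩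
  · rintro ⟨z, hz, rfl⟩
    rwa [mulCayley_dist_eq hS, inv_mul_cancel_left]

end Cayley

/-! ### Coarsely Lipschitz maps, without reference to generating sets. -/

section Controlled

open SimpleGraph

variable {Γ Δ : Type*} [Group Γ] [Group Δ]

/-- A map between groups is controlled if it is coarsely Lipschitz for the word metrics: right
multiplication by a fixed element moves the image by finitely many possible elements. -/
def IsControlled (q : Γ → Δ) : Prop :=
  ∀ g : Γ, (Set.range fun w => (q w)⁻¹ * q (w * g)).Finite

/-- The displacement q(w)⁻¹q(wab) factors as q(w)⁻¹q(wa) · q(wa)⁻¹q(wab), so the elements with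
finitely many displacements form a subgroup. The generating set may be infinite. -/
theorem isControlled_of_closure {q : Γ → Δ} {U : Set Γ} (hU : Subgroup.closure U = ⊤)
    (h : ∀ u ∈ U, (Set.range fun w => (q w)⁻¹ * q (w * u)).Finite) : IsControlled q := by
  let K : Subgroup Γ :=
    { carrier := {g | (Set.range fun w => (q w)⁻¹ * q (w * g)).Finite}
      one_mem' := by
        refine (Set.finite_singleton 1).subset ?_
        rintro _ ⟨w, rfl⟩
        simp
      mul_mem' := fun {a b} ha hb => by
        refine (Set.Finite.image2 (· * ·) ha hb).subset ?_
        rintro _ ⟨w, rfl⟩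
        exact ⟨_, ⟨w, rfl⟩, _, ⟨w * a, rfl⟩, by simp [mul_assoc]⟩
      inv_mem' := fun {a} ha => by
        refine (Set.Finite.inv ha).subset ?_
        rintro _ ⟨w, rfl⟩
        exact ⟨w * a⁻¹, by simp⟩ }
  have hK : K = ⊤ := by
    rw [eq_top_iff, ← hU, Subgroup.closure_le]
    exact h
  intro g
  have : g ∈ K := hK ▸ Subgroup.mem_top g
  exact this

theorem IsControlled.exists_lipschitz {q : Γ → Δ} (hq : IsControlled q) {U : Set Γ} {V : Set Δ}
    (hU : IsFiniteGeneratingSet U) (hV : IsFiniteGeneratingSet V) :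
    ∃ L : ℕ, ∀ w w', (mulCayley V).dist (q w) (q w') ≤ L * (mulCayley U).dist w w' := by
  obtain ⟨L, hL⟩ := exists_dist_le_of_finite V (hU.1.biUnion fun u _ => hq u)
  have hstep : ∀ w, ∀ u ∈ U, (mulCayley V).dist (q w) (q (w * u)) ≤ L := fun w u hu => by
    rw [mulCayley_dist_eq hV.2]
    exact hL _ (Set.mem_biUnion hu ⟨w, rfl⟩)
  have hadj : ∀ w w', (mulCayley U).Adj w w' → (mulCayley V).dist (q w) (q w') ≤ L := by
    intro w w' h
    rcases (mulCayley_adj _ _ _).1 h with ⟨-, h | h⟩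
    · simpa using hstep w _ h
    · rw [dist_comm]
      simpa using hstep w' _ h
  refine ⟨L, fun w w' => ?_⟩
  obtain ⟨p, hp⟩ := (mulCayley_connected hU.2).exists_walk_length_eq_dist w w'
  rw [← hp]
  clear hp
  induction p with
  | nil => simp
  | cons h p ih =>
    refine ((mulCayley_connected hV.2).dist_triangle).trans ((add_le_add (hadj _ _ h) ih).trans ?_)
    rw [Walk.length_cons]
    exact le_of_eq (by ring)

theorem finite_range_of_dist_le {ι : Type*} {V : Set Δ} (hV : IsFiniteGeneratingSet V)
    {a b : ι → Δ} {r : ℕ} (h : ∀ i, (mulCayley V).dist (a i) (b i) ≤ r) :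
    (Set.range fun i => (a i)⁻¹ * b i).Finite := by
  refine (finite_ball_one hV r).subset ?_
  rintro _ ⟨i, rfl⟩
  rw [Set.mem_ofPred_eq, ← mulCayley_dist_eq hV.2]
  exact h i

theorem isControlled_of_dist {q : Γ → Δ} {U : Set Γ} {V : Set Δ}
    (hU : IsFiniteGeneratingSet U) (hV : IsFiniteGeneratingSet V) {C K : ℝ}
    (h : ∀ w w', ((mulCayley V).dist (q w) (q w') : ℝ) ≤ C * (mulCayley U).dist w w' + K) :
    IsControlled q := by
  refine isControlled_of_closure hU.2 fun u _ => ?_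
  refine finite_range_of_dist_le hV (r := ⌈C * (mulCayley U).dist 1 u + K⌉₊) fun w => ?_
  have h1 := (h w (w * u)).trans (Nat.le_ceil _)
  rw [mulCayley_dist_eq hU.2 w, inv_mul_cancel_left] at h1
  exact_mod_cast h1

/-- Mutually coarsely inverse controlled maps are quasi-isometries. -/
theorem IsControlled.isQuasiIsometry {q : Γ → Δ} {r : Δ → Γ} (hq : IsControlled q)
    (hr : IsControlled r) (hrq : (Set.range fun w => (r (q w))⁻¹ * w).Finite)
    (hqr : (Set.range fun w => (q (r w))⁻¹ * w).Finite) {U : Set Γ} {V : Set Δ}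
    (hU : IsFiniteGeneratingSet U) (hV : IsFiniteGeneratingSet V) :
    IsQuasiIsometry (mulCayley U) (mulCayley V) q := by
  obtain ⟨L₁, h₁⟩ := hq.exists_lipschitz hU hV
  obtain ⟨L₂, h₂⟩ := hr.exists_lipschitz hV hU
  obtain ⟨K₁, hK₁⟩ := exists_dist_le_of_finite U hrq
  obtain ⟨K₂, hK₂⟩ := exists_dist_le_of_finite V hqr
  -- One constant dominates both Lipschitz constants; the summand 1 ensures C ≥ 1.
  set C : ℝ := L₁ + L₂ + 1 with hC
  have hC1 : 1 ≤ C := by rw [hC]; linarith [L₁.cast_nonneg (α := ℝ), L₂.cast_nonneg (α := ℝ)]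
  refine ⟨C, 2 * K₁ + K₂, hC1, by positivity, fun x y => ⟨?_, ?_⟩, fun y => ⟨r y, ?_⟩⟩
  · have e1 : (mulCayley U).dist (r (q x)) x ≤ K₁ := by
      rw [mulCayley_dist_eq hU.2]; exact hK₁ _ ⟨x, rfl⟩
    have e2 : (mulCayley U).dist (r (q y)) y ≤ K₁ := by
      rw [mulCayley_dist_eq hU.2]; exact hK₁ _ ⟨y, rfl⟩
    have e3 : (mulCayley U).dist x y ≤ 2 * K₁ + L₂ * (mulCayley V).dist (q x) (q y) := by
      have t1 := (mulCayley_connected hU.2).dist_triangle (u := x) (v := r (q x)) (w := y)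
      have t2 := (mulCayley_connected hU.2).dist_triangle (u := r (q x)) (v := r (q y)) (w := y)
      have := h₂ (q x) (q y)
      rw [dist_comm (u := x) (v := r (q x))] at t1
      omega
    have e4 : ((mulCayley U).dist x y : ℝ) ≤ 2 * K₁ + L₂ * (mulCayley V).dist (q x) (q y) := by
      exact_mod_cast e3
    have hd : (0 : ℝ) ≤ (mulCayley V).dist (q x) (q y) := Nat.cast_nonneg _
    have e5 : ((mulCayley U).dist x y : ℝ) ≤
        C * ((mulCayley V).dist (q x) (q y) + (2 * K₁ + K₂)) := by
      have hL : (L₂ : ℝ) ≤ C := by rw [hC]; linarith [L₁.cast_nonneg (α := ℝ)]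
      have a1 := mul_le_mul_of_nonneg_right hL hd
      have a2 : (2 * K₁ + K₂ : ℝ) ≤ C * (2 * K₁ + K₂) := le_mul_of_one_le_left (by positivity) hC1
      rw [mul_add]
      linarith [K₂.cast_nonneg (α := ℝ)]
    have e6 : 1 / C * ((mulCayley U).dist x y : ℝ) ≤
        (mulCayley V).dist (q x) (q y) + (2 * K₁ + K₂) := by
      rw [one_div, inv_mul_le_iff₀ (by linarith)]
      exact e5
    linarith
  · have a1 : ((mulCayley V).dist (q x) (q y) : ℝ) ≤ L₁ * (mulCayley U).dist x y := by
      exact_mod_cast h₁ x y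
    have hL : (L₁ : ℝ) ≤ C := by rw [hC]; linarith [L₂.cast_nonneg (α := ℝ)]
    have a2 := mul_le_mul_of_nonneg_right hL ((mulCayley U).dist x y).cast_nonneg
    have : (0 : ℝ) ≤ 2 * K₁ + K₂ := by positivity
    linarith
  · have : (mulCayley V).dist (q (r y)) y ≤ K₂ := by
      rw [mulCayley_dist_eq hV.2]; exact hK₂ _ ⟨y, rfl⟩
    rw [dist_comm]
    have h' : ((mulCayley V).dist (q (r y)) y : ℝ) ≤ K₂ := by exact_mod_cast this
    have : (0 : ℝ) ≤ 2 * K₁ := by positivity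
    linarith

theorem isQuasiInverse_of_finite {q : Γ → Δ} {r : Δ → Γ}
    (hrq : (Set.range fun w => (r (q w))⁻¹ * w).Finite)
    (hqr : (Set.range fun w => (q (r w))⁻¹ * w).Finite) {U : Set Γ} {V : Set Δ}
    (hU : IsFiniteGeneratingSet U) (hV : IsFiniteGeneratingSet V) :
    IsQuasiInverse (mulCayley U) (mulCayley V) q r := by
  obtain ⟨K₁, hK₁⟩ := exists_dist_le_of_finite U hrq
  obtain ⟨K₂, hK₂⟩ := exists_dist_le_of_finite V hqr
  refine ⟨(max K₁ K₂ : ℕ), fun x => ?_, fun y => ?_⟩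
  · rw [mulCayley_dist_eq hU.2]
    exact_mod_cast (hK₁ _ ⟨x, rfl⟩).trans (le_max_left _ _)
  · rw [mulCayley_dist_eq hV.2]
    exact_mod_cast (hK₂ _ ⟨y, rfl⟩).trans (le_max_right _ _)

end Controlled

/-! ### Bounded-distance matchings of point families in a graph. -/

section Matching

variable {W X Z : Type*}

/-- Balls are finite, with cardinality bounded in terms of the radius. -/
def HasBoundedBalls (Y : SimpleGraph W) : Prop :=
  ∀ r : ℕ, ∃ b : ℕ, ∀ x, {y | Y.dist x y ≤ r}.Finite ∧ {y | Y.dist x y ≤ r}.ncard ≤ b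

/-- Every point is at bounded distance from the image. -/
def IsCoarselyDense (Y : SimpleGraph W) (f : X → W) : Prop :=
  ∃ K : ℕ, ∀ y, ∃ x, Y.dist y (f x) ≤ K

/-- The closed `r`-neighbourhood of `B`. -/
def thickening (Y : SimpleGraph W) (B : Set W) (r : ℕ) : Set W :=
  {y | ∃ x ∈ B, Y.dist x y ≤ r}

theorem thickening_mono (Y : SimpleGraph W) (B : Set W) : Monotone (thickening Y B) :=
  fun _ _ h _ ⟨x, hx, hd⟩ => ⟨x, hx, hd.trans h⟩

theorem subset_thickening (Y : SimpleGraph W) (B : Set W) (r : ℕ) : B ⊆ thickening Y B r :=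
  fun x hx => ⟨x, hx, by simp⟩

theorem mem_thickening_add {Y : SimpleGraph W} (hY : Y.Connected) {B : Set W} {r s : ℕ} {x y : W}
    (hx : x ∈ thickening Y B r) (h : Y.dist x y ≤ s) : y ∈ thickening Y B (r + s) := by
  obtain ⟨b, hb, hd⟩ := hx
  exact ⟨b, hb, hY.dist_triangle.trans (add_le_add hd h)⟩

theorem HasBoundedBalls.finite_thickening {Y : SimpleGraph W} (hY : HasBoundedBalls Y) {B : Set W}
    (hB : B.Finite) (r : ℕ) : (thickening Y B r).Finite := by
  obtain ⟨b, hb⟩ := hY r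
  refine (hB.biUnion fun x _ => (hb x).1).subset ?_
  rintro y ⟨x, hx, hd⟩
  exact Set.mem_biUnion hx hd

theorem vertexBoundary_thickening_subset {Y : SimpleGraph W} (hY : Y.Connected) (B : Set W)
    (r : ℕ) : vertexBoundary Y (thickening Y B r) ⊆ thickening Y B (r + 1) \ thickening Y B r := by
  rintro y ⟨hy, x, hx, hxy⟩
  exact ⟨mem_thickening_add hY hx (SimpleGraph.dist_eq_one_iff_adj.2 hxy).le, hy⟩

theorem finite_preimage {f : X → W} (hf : ∀ y, (f ⁻¹' {y}).Finite) {A : Set W} (hA : A.Finite) :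
    (f ⁻¹' A).Finite :=
  hA.preimage' fun b _ => hf b

/-- Choosing for each y in E a point whose image is within K of y is at most b-to-one, since the
fibre over a lies in the K-ball around f(a). -/
theorem ncard_le_mul_ncard_preimage {Y : SimpleGraph W} {f : X → W}
    (hf : ∀ y, (f ⁻¹' {y}).Finite) {K b : ℕ} (hK : ∀ y, ∃ x, Y.dist y (f x) ≤ K)
    (hb : ∀ x, {y | Y.dist x y ≤ K}.Finite ∧ {y | Y.dist x y ≤ K}.ncard ≤ b)
    {E F : Set W} (hE : E.Finite) (hF : F.Finite) (h : ∀ y ∈ E, ∀ w, Y.dist y w ≤ K → w ∈ F) :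
    E.ncard ≤ b * (f ⁻¹' F).ncard := by
  classical
  choose x hx using hK
  rw [Set.ncard_eq_toFinset_card E hE]
  refine (Finset.card_le_mul_card_image (f := x) hE.toFinset b ?_).trans ?_
  · intro a _
    refine le_trans ?_ (hb (f a)).2
    rw [← Set.ncard_coe_finset]
    refine Set.ncard_le_ncard ?_ (hb (f a)).1
    intro y hy
    rw [Finset.mem_coe, Finset.mem_filter] at hy
    rw [Set.mem_ofPred_eq, SimpleGraph.dist_comm, ← hy.2]
    exact hx y
  · refine Nat.mul_le_mul_left b ?_
    rw [← Set.ncard_coe_finset]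
    refine Set.ncard_le_ncard ?_ (finite_preimage hf hF)
    intro a ha
    obtain ⟨y, hy, rfl⟩ := Finset.mem_image.1 (Finset.mem_coe.1 ha)
    exact h y (hE.mem_toFinset.1 hy) _ (hx y)

/-- The smallest of L consecutive increments is at most their average, and their sum telescopes. -/
theorem exists_small_increment (N : ℕ → ℕ) (hN : Monotone N) {L : ℕ} (hL : 0 < L) :
    ∃ j, 1 ≤ j ∧ j ≤ L ∧ L * (N (j + 1) - N j) ≤ N (L + 1) - N 1 := by
  obtain ⟨j, hj, hmin⟩ := Finset.exists_min_image (Finset.range L)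
    (fun i => N (i + 1 + 1) - N (i + 1)) ⟨0, Finset.mem_range.2 hL⟩
  refine ⟨j + 1, by omega, by have := Finset.mem_range.1 hj; omega, ?_⟩
  have h1 := Finset.card_nsmul_le_sum _ _ _ hmin
  have h2 := Finset.sum_range_tsub (f := fun i => N (i + 1)) (fun a b h => hN (by omega)) L
  simp only [Finset.card_range, smul_eq_mul] at h1
  simpa [h2] using h1

theorem ncard_preimage_add {f : X → W} (hf : ∀ y, (f ⁻¹' {y}).Finite) {A B : Set W}
    (hB : B.Finite) (h : A ⊆ B) :
    (f ⁻¹' A).ncard + (f ⁻¹' (B \ A)).ncard = (f ⁻¹' B).ncard := by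
  rw [Set.preimage_sdiff, add_comm]
  exact Set.ncard_sdiff_add_ncard_of_subset (Set.preimage_mono h) (finite_preimage hf hB)

/-- This is Hall's condition. Pass from B to a thickening B_r whose boundary lies in an annulus
small compared with the remaining ones. The annuli inside contain many points of f not counted over
B, those outside contain many extra points of g, and together they pay for the error C|∂B_r|. -/
theorem exists_ncard_preimage_le_thickening {Y : SimpleGraph W} (hY : Y.Connected)
    (hball : HasBoundedBalls Y) {f : X → W} {g : Z → W} (hf : ∀ y, (f ⁻¹' {y}).Finite)
    (hg : ∀ y, (g ⁻¹' {y}).Finite) (hfK : IsCoarselyDense Y f) (hgK : IsCoarselyDense Y g) {C : ℕ}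
    (hC : ∀ A : Finset W, (f ⁻¹' (A : Set W)).ncard ≤
      (g ⁻¹' (A : Set W)).ncard + C * (vertexBoundary Y (A : Set W)).ncard) :
    ∃ R : ℕ, ∀ B : Set W, B.Finite → (f ⁻¹' B).ncard ≤ (g ⁻¹' thickening Y B R).ncard := by
  obtain ⟨K₁, hK₁⟩ := hfK
  obtain ⟨K₂, hK₂⟩ := hgK
  set K := max K₁ K₂
  replace hK₁ : ∀ y, ∃ x, Y.dist y (f x) ≤ K := fun y =>
    (hK₁ y).imp fun _ h => h.trans (le_max_left _ _)
  replace hK₂ : ∀ y, ∃ x, Y.dist y (g x) ≤ K := fun y =>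
    (hK₂ y).imp fun _ h => h.trans (le_max_right _ _)
  obtain ⟨b, hb⟩ := hball K
  -- Annuli of width 2K + 1 leave a margin K on either side of the boundary layer of width 1, so
  -- replacing a vertex by a nearby image point does not cross radius r = sj + K.
  set s := 2 * K + 1
  -- With δ the size of the chosen annulus, the others have total size at least (L - 1)δ = Cbδ;
  -- density then yields at least Cδ points in them.
  set L := C * b + 1
  refine ⟨s * (L + 1) + K, fun B hB => ?_⟩
  have hfin := hball.finite_thickening hB
  have hmono := thickening_mono Y B
  obtain ⟨j, hj1, hjL, hj⟩ := exists_small_increment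
    (fun i => (thickening Y B (s * i)).ncard)
    (fun i k h => Set.ncard_le_ncard (hmono (Nat.mul_le_mul_left s h)) (hfin _)) (L := L)
    (Nat.succ_pos _)
  have hsj : s * (j + 1) = s * j + s := by ring
  have hsj1 : s ≤ s * j := Nat.le_mul_of_pos_right s hj1
  have hsjL : s * (j + 1) ≤ s * (L + 1) := Nat.mul_le_mul_left s (by omega)
  set r := s * j + K
  -- the boundary is contained in the `j`-th annulus
  have h1 : (vertexBoundary Y (thickening Y B r)).ncard ≤
      (thickening Y B (s * (j + 1))).ncard - (thickening Y B (s * j)).ncard := by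
    rw [← Set.ncard_sdiff (hmono (by omega)) (hfin _)]
    refine Set.ncard_le_ncard ((vertexBoundary_thickening_subset hY B r).trans ?_)
      ((hfin _).subset Set.sdiff_subset)
    exact Set.sdiff_subset_sdiff (hmono (by omega)) (hmono (by omega))
  have h2 : (thickening Y B (s * j)).ncard - (thickening Y B (s * 1)).ncard ≤
      b * (f ⁻¹' (thickening Y B r \ B)).ncard := by
    rw [← Set.ncard_sdiff (hmono (by omega)) (hfin _)]
    refine ncard_le_mul_ncard_preimage hf hK₁ hb ((hfin _).subset Set.sdiff_subset)
      ((hfin _).subset Set.sdiff_subset) fun y hy w hw => ⟨mem_thickening_add hY hy.1 hw, ?_⟩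
    intro hwB
    rw [SimpleGraph.dist_comm] at hw
    exact hy.2 ⟨w, hwB, by omega⟩
  have h3 : (thickening Y B (s * (L + 1))).ncard - (thickening Y B (s * (j + 1))).ncard ≤
      b * (g ⁻¹' (thickening Y B (s * (L + 1) + K) \ thickening Y B r)).ncard := by
    rw [← Set.ncard_sdiff (hmono (by omega)) (hfin _)]
    refine ncard_le_mul_ncard_preimage hg hK₂ hb ((hfin _).subset Set.sdiff_subset)
      ((hfin _).subset Set.sdiff_subset) fun y hy w hw => ⟨mem_thickening_add hY hy.1 hw, ?_⟩
    intro hwB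
    rw [SimpleGraph.dist_comm] at hw
    exact hy.2 (hmono (by omega) (mem_thickening_add hY hwB hw))
  have h4 := hC (hfin r).toFinset
  rw [(hfin r).coe_toFinset] at h4
  have h5 := ncard_preimage_add hf (hfin r) (subset_thickening Y B r)
  have h6 := ncard_preimage_add hg (hfin (s * (L + 1) + K)) (hmono (by omega : r ≤ s * (L + 1) + K))
  have n1 : (thickening Y B (s * 1)).ncard ≤ (thickening Y B (s * j)).ncard :=
    Set.ncard_le_ncard (hmono (by omega)) (hfin _)
  have n2 : (thickening Y B (s * j)).ncard ≤ (thickening Y B (s * (j + 1))).ncard :=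
    Set.ncard_le_ncard (hmono (by omega)) (hfin _)
  have n3 : (thickening Y B (s * (j + 1))).ncard ≤ (thickening Y B (s * (L + 1))).ncard :=
    Set.ncard_le_ncard (hmono (by omega)) (hfin _)
  set u := (f ⁻¹' (thickening Y B r \ B)).ncard
  set v := (g ⁻¹' (thickening Y B (s * (L + 1) + K) \ thickening Y B r)).ncard
  set d := (vertexBoundary Y (thickening Y B r)).ncard
  have key : C * d ≤ u + v := by
    set δ := (thickening Y B (s * (j + 1))).ncard - (thickening Y B (s * j)).ncard
    have e1 : C * b * δ ≤ b * (u + v) := by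
      have : L * δ = C * b * δ + δ := by ring
      rw [mul_add]
      omega
    -- The factor b can be cancelled unless it is 0, in which case the graph would be empty.
    rcases Nat.eq_zero_or_pos b with hb0 | hb0
    · have e0 : ∀ x : W, False := fun x => by
        have := (Set.ncard_pos (hb x).1).2 ⟨x, by simp⟩
        have := (hb x).2
        omega
      have : d = 0 := by
        have : IsEmpty W := ⟨e0⟩
        simp [d, Set.eq_empty_of_isEmpty]
      simp [this]
    · have e2 : b * (C * d) ≤ b * (u + v) := by
        refine le_trans ?_ e1
        calc b * (C * d) ≤ b * (C * δ) := by gcongr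
          _ = C * b * δ := by ring
      exact Nat.le_of_mul_le_mul_left e2 hb0
  omega

theorem exists_injective_dist_le {Y : SimpleGraph W} (hY : Y.Connected)
    (hball : HasBoundedBalls Y) {f : X → W} {g : Z → W} (hf : ∀ y, (f ⁻¹' {y}).Finite)
    (hg : ∀ y, (g ⁻¹' {y}).Finite) (hfK : IsCoarselyDense Y f) (hgK : IsCoarselyDense Y g) {C : ℕ}
    (hC : ∀ A : Finset W, (f ⁻¹' (A : Set W)).ncard ≤
      (g ⁻¹' (A : Set W)).ncard + C * (vertexBoundary Y (A : Set W)).ncard) :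
    ∃ (R : ℕ) (φ : X → Z), Function.Injective φ ∧ ∀ x, Y.dist (f x) (g (φ x)) ≤ R := by
  classical
  obtain ⟨R, hR⟩ := exists_ncard_preimage_le_thickening hY hball hf hg hfK hgK hC
  have hfin : ∀ x : X, (g ⁻¹' {y | Y.dist (f x) y ≤ R}).Finite := fun x =>
    finite_preimage hg ((hball R).choose_spec (f x)).1
  obtain ⟨φ, hφ, hφR⟩ := (Finset.all_card_le_biUnion_card_iff_exists_injective
    (fun x => (hfin x).toFinset)).1 fun s => by
      have h := hR (s.image f : Finset W) (Finset.finite_toSet _)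
      have h1 : s.card ≤ (f ⁻¹' ((s.image f : Finset W) : Set W)).ncard := by
        rw [← Set.ncard_coe_finset]
        refine Set.ncard_le_ncard (fun x hx => ?_) (finite_preimage hf (Finset.finite_toSet _))
        exact Finset.mem_coe.2 (Finset.mem_image_of_mem f hx)
      refine h1.trans (h.trans ?_)
      rw [← Set.ncard_coe_finset]
      refine Set.ncard_le_ncard ?_ (Finset.finite_toSet _)
      rintro z ⟨y, hy, hd⟩
      obtain ⟨x, hx, rfl⟩ := Finset.mem_image.1 (Finset.mem_coe.1 hy)
      exact Finset.mem_coe.2 (Finset.mem_biUnion.2 ⟨x, hx, (hfin x).mem_toFinset.2 hd⟩)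
  exact ⟨R, φ, hφ, fun x => (hfin x).mem_toFinset.1 (hφR x)⟩

/-- Two coarsely dense families of points with the same number of points in each finite set, up to
an error controlled by the boundary, are matched by a bijection at bounded distance. -/
theorem exists_equiv_dist_le {Y : SimpleGraph W} (hY : Y.Connected)
    (hball : HasBoundedBalls Y) {f : X → W} {g : Z → W} (hf : ∀ y, (f ⁻¹' {y}).Finite)
    (hg : ∀ y, (g ⁻¹' {y}).Finite) (hfK : IsCoarselyDense Y f) (hgK : IsCoarselyDense Y g) {C : ℝ}
    (hC : ∀ A : Finset W, |((f ⁻¹' (A : Set W)).ncard : ℝ) - (g ⁻¹' (A : Set W)).ncard| ≤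
      C * (vertexBoundary Y (A : Set W)).ncard) :
    ∃ (R : ℕ) (φ : X ≃ Z), ∀ x, Y.dist (f x) (g (φ x)) ≤ R := by
  have hC' : ∀ A : Finset W, |((f ⁻¹' (A : Set W)).ncard : ℝ) - (g ⁻¹' (A : Set W)).ncard| ≤
      ⌈C⌉₊ * (vertexBoundary Y (A : Set W)).ncard := fun A =>
    (hC A).trans (mul_le_mul_of_nonneg_right (Nat.le_ceil C) (Nat.cast_nonneg _))
  obtain ⟨R₁, φ, hφ, h₁⟩ := exists_injective_dist_le hY hball hf hg hfK hgK (C := ⌈C⌉₊)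
    fun A => by
      have := (abs_le.1 (hC' A)).2
      have h : ((f ⁻¹' (A : Set W)).ncard : ℝ) ≤ (g ⁻¹' (A : Set W)).ncard +
          ⌈C⌉₊ * (vertexBoundary Y (A : Set W)).ncard := by linarith
      exact_mod_cast h
  obtain ⟨R₂, ψ, hψ, h₂⟩ := exists_injective_dist_le hY hball hg hf hgK hfK (C := ⌈C⌉₊)
    fun A => by
      have := (abs_le.1 (hC' A)).1
      have h : ((g ⁻¹' (A : Set W)).ncard : ℝ) ≤ (f ⁻¹' (A : Set W)).ncard +
          ⌈C⌉₊ * (vertexBoundary Y (A : Set W)).ncard := by linarith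
      exact_mod_cast h
  -- The Schröder–Bernstein bijection only uses pairs coming from φ or ψ, so it inherits their
  -- distance bounds.
  obtain ⟨h, hbij, hR⟩ := Function.Embedding.schroeder_bernstein_of_rel hφ hψ
    (fun x z => Y.dist (f x) (g z) ≤ max R₁ R₂) (fun x => (h₁ x).trans (le_max_left _ _))
    (fun z => by
      rw [SimpleGraph.dist_comm]
      exact (h₂ z).trans (le_max_right _ _))
  exact ⟨max R₁ R₂, Equiv.ofBijective h hbij, hR⟩

end Matching

/-! ### Weights of density 1/n and the block decompositions. -/

section Weight

variable {W : Type*}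

theorem vertexBoundary_nonempty {Y : SimpleGraph W} (hY : Y.Connected) {A : Set W}
    (hA : A.Nonempty) (hA' : A ≠ Set.univ) : (vertexBoundary Y A).Nonempty := by
  obtain ⟨u, hu⟩ := hA
  obtain ⟨v, hv⟩ := (Set.ne_univ_iff_exists_notMem A).1 hA'
  obtain ⟨p⟩ := hY.preconnected u v
  obtain ⟨d, -, h1, h2⟩ := p.exists_boundary_dart A hu hv
  exact ⟨d.snd, h2, d.fst, h1, d.adj⟩

theorem HasBoundedBalls.finite_vertexBoundary {Y : SimpleGraph W} (hY : HasBoundedBalls Y)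
    {A : Set W} (hA : A.Finite) : (vertexBoundary Y A).Finite := by
  refine (hY.finite_thickening hA 1).subset ?_
  rintro y ⟨-, x, hx, hxy⟩
  exact ⟨x, hx, (SimpleGraph.dist_eq_one_iff_adj.2 hxy).le⟩

/-- A connected graph has a map moving every vertex other than the root one step towards it. -/
theorem exists_parent {Y : SimpleGraph W} (hY : Y.Connected) (o : W) :
    ∃ π : W → W, ∀ v, v ≠ o → Y.Adj v (π v) ∧ Y.dist o v = Y.dist o (π v) + 1 := by
  have h : ∀ v, ∃ w, v ≠ o → Y.Adj v w ∧ Y.dist o v = Y.dist o w + 1 := by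
    intro v
    by_cases hv : v = o
    · exact ⟨o, fun h => absurd hv h⟩
    obtain ⟨p, hp⟩ := hY.exists_walk_length_eq_dist v o
    cases p with
    | nil => exact absurd rfl hv
    | @cons _ w _ hadj q =>
      refine ⟨w, fun _ => ⟨hadj, ?_⟩⟩
      have h1 := SimpleGraph.dist_le q
      have h2 := hY.dist_triangle (u := v) (v := w) (w := o)
      rw [SimpleGraph.dist_eq_one_iff_adj.2 hadj] at h2
      rw [SimpleGraph.Walk.length_cons] at hp
      rw [SimpleGraph.dist_comm, SimpleGraph.dist_comm (u := o)]
      omega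
  choose π hπ using h
  exact ⟨π, hπ⟩

/-- The number, modulo `n`, of descendants up to relative depth `k`. -/
def descendantCount (n : ℕ) (ch : W → Finset W) : ℕ → W → ZMod n
  | 0, _ => 0
  | k + 1, v => 1 + ∑ u ∈ ch v, descendantCount n ch k u

/-- On a locally finite forest, the equations `a v = 1 + ∑ a u (mod n)`, the sum being over the
children of `v`, have a simultaneous solution. -/
theorem exists_flow (n : ℕ) [NeZero n] (ch : W → Finset W) (δ : W → ℕ)
    (hδ : ∀ v, ∀ u ∈ ch v, δ u = δ v + 1) :
    ∃ a : W → ℕ, (∀ v, a v < n) ∧ ∀ v, a v = (1 + ∑ u ∈ ch v, a u) % n := by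
  -- Truncating at absolute depth R solves the equations above that depth. As residues modulo n take
  -- finitely many values, each count is constant along a nonprincipal ultrafilter in R; a finite
  -- set of equations is then satisfied at a common R.
  have hex : ∀ v, ∃ x : ZMod n, ∀ᶠ R in (Filter.hyperfilter ℕ : Filter ℕ),
      descendantCount n ch (R - δ v) v = x := fun v =>
    Ultrafilter.eventually_exists_iff.1 (Filter.Eventually.of_forall fun R => ⟨_, rfl⟩)
  choose x hx using hex
  have heq : ∀ v, x v = 1 + ∑ u ∈ ch v, x u := by
    intro v
    have h1 : ∀ᶠ R in (Filter.hyperfilter ℕ : Filter ℕ), ∀ u ∈ ch v,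
        descendantCount n ch (R - δ u) u = x u :=
      (Finset.eventually_all (ch v)).2 fun u _ => hx u
    have h2 : ∀ᶠ R in (Filter.hyperfilter ℕ : Filter ℕ), δ v + 1 ≤ R :=
      (Filter.eventually_ge_atTop (δ v + 1)).filter_mono Nat.hyperfilter_le_atTop
    obtain ⟨R, hR, hR1, hR2⟩ := ((hx v).and (h1.and h2)).exists
    rw [← hR, show R - δ v = (R - (δ v + 1)) + 1 by omega, descendantCount]
    congr 1
    refine Finset.sum_congr rfl fun u hu => ?_
    rw [← hR1 u hu, hδ v u hu]
  refine ⟨fun v => (x v).val, fun v => ZMod.val_lt _, fun v => ?_⟩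
  have : ((1 + ∑ u ∈ ch v, (x u).val : ℕ) : ZMod n) = x v := by
    rw [heq v]
    push_cast
    simp
  change (x v).val = (1 + ∑ u ∈ ch v, (x u).val) % n
  rw [← this, ZMod.val_natCast]

/-- `t` is a weight of density `1 / n`, up to an error controlled by the boundary. -/
def IsWeight (Y : SimpleGraph W) (n : ℕ) (t : W → ℕ) : Prop :=
  (∃ K : ℕ, ∀ y, ∃ v, 0 < t v ∧ Y.dist y v ≤ K) ∧
    ∃ C : ℝ, ∀ A : Finset W, |(n : ℝ) * (∑ v ∈ A, t v : ℕ) - A.card| ≤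
      C * (vertexBoundary Y (A : Set W)).ncard

/-- Let a(v) be the remainder sent from v to its parent. Summing the conservation law over A, the
flows cancel except across the boundary and at the root, where the remainder is lost. Since each
flow is below n, the error is a multiple of |∂A|. -/
theorem exists_isWeight_of_infinite [Infinite W] {Y : SimpleGraph W} (hY : Y.Connected)
    (hball : HasBoundedBalls Y) {n : ℕ} (hn : 0 < n) : ∃ t : W → ℕ, IsWeight Y n t := by
  classical
  have : NeZero n := ⟨hn.ne'⟩
  obtain ⟨o⟩ := hY.nonempty
  obtain ⟨π, hπ⟩ := exists_parent hY o
  obtain ⟨b, hb⟩ := hball 1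
  have hchfin : ∀ v, {u | u ≠ o ∧ π u = v}.Finite := fun v => by
    refine (hb v).1.subset ?_
    rintro u ⟨hu, rfl⟩
    exact (SimpleGraph.dist_eq_one_iff_adj.2 (hπ u hu).1.symm).le
  set ch : W → Finset W := fun v => (hchfin v).toFinset with hch
  have hmem : ∀ u v, u ∈ ch v ↔ u ≠ o ∧ π u = v := fun u v => (hchfin v).mem_toFinset
  obtain ⟨a, han, ha⟩ := exists_flow n ch (Y.dist o) fun v u hu => by
    obtain ⟨h1, rfl⟩ := (hmem u v).1 hu
    exact (hπ u h1).2
  set t : W → ℕ := fun v => (1 + ∑ u ∈ ch v, a u) / n with ht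
  have hta : ∀ v, n * t v + a v = 1 + ∑ u ∈ ch v, a u := fun v => by
    rw [ha v]
    exact Nat.div_add_mod _ _
  -- The extra unit at the root makes its weight positive, so that the search towards the root
  -- always ends at positive weight.
  refine ⟨fun v => t v + if v = o then 1 else 0, ⟨n, ?_⟩, ?_⟩
  · have key : ∀ k v, n - a v ≤ k → ∃ w, 0 < (t w + if w = o then 1 else 0) ∧
        Y.dist v w ≤ n - a v := by
      intro k
      induction k with
      | zero => intro v hv; have := han v; omega
      | succ k ih =>
        intro v hv
        by_cases h0 : 0 < (t v + if v = o then 1 else 0)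
        · exact ⟨v, h0, by simp⟩
        have hvo : v ≠ o := by
          rintro rfl
          simp at h0
        have hd : Y.dist v (π v) = 1 := SimpleGraph.dist_eq_one_iff_adj.2 (hπ v hvo).1
        have hv1 := han v
        by_cases h1 : 0 < (t (π v) + if π v = o then 1 else 0)
        · exact ⟨π v, h1, by omega⟩
        have h2 : t (π v) = 0 := by omega
        have h3 := hta (π v)
        have h4 : a v ≤ ∑ u ∈ ch (π v), a u :=
          Finset.single_le_sum (f := a) (fun _ _ => Nat.zero_le _) ((hmem v _).2 ⟨hvo, rfl⟩)
        rw [h2] at h3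
        obtain ⟨w, hw, hdw⟩ := ih (π v) (by omega)
        refine ⟨w, hw, ?_⟩
        have := hY.dist_triangle (u := v) (v := π v) (w := w)
        have := han (π v)
        omega
    intro y
    obtain ⟨w, hw, hd⟩ := key _ y le_rfl
    exact ⟨w, hw, hd.trans (Nat.sub_le _ _)⟩
  · refine ⟨n * (b + 2), fun A => ?_⟩
    set d := (vertexBoundary Y (A : Set W)).ncard
    have hdfin := hball.finite_vertexBoundary A.finite_toSet
    set P := A.biUnion ch
    have hP : ∀ u, u ∈ P ↔ u ≠ o ∧ π u ∈ A := by
      intro u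
      simp only [P, Finset.mem_biUnion, hmem]
      constructor
      · rintro ⟨v, hv, h1, rfl⟩
        exact ⟨h1, hv⟩
      · rintro ⟨h1, h2⟩
        exact ⟨_, h2, h1, rfl⟩
    have hsum : ∑ v ∈ A, ∑ u ∈ ch v, a u = ∑ u ∈ P, a u := by
      refine (Finset.sum_biUnion ?_).symm
      intro v _ w _ hvw
      refine Finset.disjoint_left.2 fun u hu hu' => hvw ?_
      rw [← ((hmem u v).1 hu).2, ← ((hmem u w).1 hu').2]
    have htot : n * ∑ v ∈ A, t v + ∑ v ∈ A, a v = A.card + ∑ u ∈ P, a u := by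
      rw [← hsum, Finset.mul_sum, ← Finset.sum_add_distrib, Finset.card_eq_sum_ones,
        ← Finset.sum_add_distrib]
      exact Finset.sum_congr rfl fun v _ => hta v
    -- A finite set containing the root is proper, as the graph is infinite, so its nonempty
    -- boundary absorbs the root's contribution.
    have hroot : (∑ v ∈ A, if v = o then 1 else 0) ≤ d := by
      rw [Finset.sum_ite_eq']
      split_ifs with ho
      · refine (Set.ncard_pos hdfin).2 (vertexBoundary_nonempty hY ⟨o, ho⟩ ?_)
        intro h
        exact Set.infinite_univ (h ▸ A.finite_toSet)
      · exact Nat.zero_le _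
    have hsd : ∀ E F : Finset W, ∑ v ∈ E, a v ≤ ∑ v ∈ F, a v + n * (E \ F).card := by
      intro E F
      rw [← Finset.sum_inter_add_sum_sdiff E F a]
      refine add_le_add (Finset.sum_le_sum_of_subset Finset.inter_subset_right) ?_
      rw [mul_comm, ← smul_eq_mul]
      exact Finset.sum_le_card_nsmul _ _ _ fun v _ => (han v).le
    have hPA : (P \ A).card ≤ d := by
      rw [← Set.ncard_coe_finset]
      refine Set.ncard_le_ncard ?_ hdfin
      intro u hu
      obtain ⟨h1, h2⟩ := Finset.mem_sdiff.1 (Finset.mem_coe.1 hu)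
      obtain ⟨h3, h4⟩ := (hP u).1 h1
      exact ⟨h2, π u, h4, (hπ u h3).1.symm⟩
    -- A non-root vertex of A outside P has its parent in the boundary, and each boundary vertex has
    -- at most b neighbours; the root adds one more d.
    have hAP : (A \ P).card ≤ (b + 1) * d := by
      have hsub : A \ P ⊆ (A.filter (· = o)) ∪ hdfin.toFinset.biUnion
          fun y => (hb y).1.toFinset := by
        intro u hu
        obtain ⟨h1, h2⟩ := Finset.mem_sdiff.1 hu
        rw [Finset.mem_union, Finset.mem_filter, Finset.mem_biUnion]
        by_cases ho : u = o
        · exact Or.inl ⟨h1, ho⟩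
        · refine Or.inr ⟨π u, hdfin.mem_toFinset.2 ⟨fun h => h2 ((hP u).2 ⟨ho, h⟩), u, h1,
            (hπ u ho).1⟩, (hb _).1.mem_toFinset.2 ?_⟩
          exact (SimpleGraph.dist_eq_one_iff_adj.2 (hπ u ho).1.symm).le
      refine (Finset.card_le_card hsub).trans ((Finset.card_union_le _ _).trans ?_)
      have h1 : (A.filter (· = o)).card ≤ d := by
        rw [Finset.card_filter]
        exact hroot
      have h2 : (hdfin.toFinset.biUnion fun y => (hb y).1.toFinset).card ≤ d * b := by
        rw [show d = hdfin.toFinset.card from Set.ncard_eq_toFinset_card _ hdfin]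
        refine Finset.card_biUnion_le_card_mul _ _ _ fun y _ => ?_
        rw [← Set.ncard_eq_toFinset_card _ (hb y).1]
        exact (hb y).2
      calc _ ≤ d + d * b := add_le_add h1 h2
        _ = (b + 1) * d := by ring
    have e1 := (hsd P A).trans (Nat.add_le_add_left (Nat.mul_le_mul_left n hPA) _)
    have e2 := (hsd A P).trans (Nat.add_le_add_left (Nat.mul_le_mul_left n hAP) _)
    have e3 := Nat.mul_le_mul_left n hroot
    rw [Finset.sum_add_distrib]
    set ρ := ∑ v ∈ A, if v = o then 1 else 0
    have f0 : (n : ℝ) * (∑ v ∈ A, t v : ℕ) + (∑ v ∈ A, a v : ℕ) = A.card + (∑ u ∈ P, a u : ℕ) := by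
      exact_mod_cast htot
    have f1 : ((∑ u ∈ P, a u : ℕ) : ℝ) ≤ (∑ v ∈ A, a v : ℕ) + n * d := by exact_mod_cast e1
    have f2 : ((∑ v ∈ A, a v : ℕ) : ℝ) ≤ (∑ u ∈ P, a u : ℕ) + n * ((b + 1) * d) := by
      exact_mod_cast e2
    have f3 : (n : ℝ) * ρ ≤ n * d := by exact_mod_cast e3
    have f4 : (0 : ℝ) ≤ n * ρ := by positivity
    have f5 : (0 : ℝ) ≤ n * (b * d) := by positivity
    have f6 : (0 : ℝ) ≤ n * d := by positivity
    rw [Nat.cast_add, mul_add, abs_le]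
    constructor <;> nlinarith

/-- With mass k at a single vertex, the count is exact on the whole graph, the only nonempty set
without boundary; elsewhere the error is at most |W|. -/
theorem exists_isWeight_of_finite [Finite W] {Y : SimpleGraph W} (hY : Y.Connected) {n k : ℕ}
    (hk : n * k = Nat.card W) : ∃ t : W → ℕ, IsWeight Y n t := by
  classical
  obtain ⟨o⟩ := hY.nonempty
  have : Fintype W := Fintype.ofFinite W
  rw [Nat.card_eq_fintype_card] at hk
  have hcard : 0 < Fintype.card W := Fintype.card_pos_iff.2 ⟨o⟩
  have hkpos : 0 < k := Nat.pos_of_ne_zero (by rintro rfl; omega)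
  refine ⟨fun v => if v = o then k else 0, ⟨∑ y, Y.dist y o, fun y => ⟨o, by simpa, ?_⟩⟩,
    Fintype.card W, fun A => ?_⟩
  · exact Finset.single_le_sum (f := fun y => Y.dist y o) (fun _ _ => Nat.zero_le _)
      (Finset.mem_univ y)
  · rw [Finset.sum_ite_eq']
    have hk' : (n : ℝ) * k = Fintype.card W := by exact_mod_cast hk
    rcases A.eq_empty_or_nonempty with rfl | hA
    · simp
      positivity
    by_cases hA' : (A : Set W) = Set.univ
    · obtain rfl : A = Finset.univ := by simpa using hA'
      rw [if_pos (Finset.mem_univ o), Finset.card_univ, hk']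
      simp
      positivity
    · have h1 : (1 : ℝ) ≤ (vertexBoundary Y (A : Set W)).ncard := by
        exact_mod_cast (Set.ncard_pos (Set.toFinite _)).2 (vertexBoundary_nonempty hY hA hA')
      have h2 : (A.card : ℝ) ≤ Fintype.card W := by exact_mod_cast Finset.card_le_univ A
      have h3 : (0 : ℝ) ≤ A.card := Nat.cast_nonneg _
      refine le_trans ?_ (le_mul_of_one_le_right (Nat.cast_nonneg _) h1)
      split_ifs
      · rw [hk', abs_le]
        constructor <;> linarith
      · simpa using h2

/-- The family of points of `W` in which `v` is repeated `t v * k` times. -/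
def weightPoint (t : W → ℕ) (k : ℕ) (x : (Σ v, Fin (t v)) × Fin k) : W :=
  x.1.1

theorem weightPoint_preimage (t : W → ℕ) (k : ℕ) (A : Finset W) :
    weightPoint t k ⁻¹' (A : Set W) =
      ((A.sigma fun _ => Finset.univ) ×ˢ Finset.univ : Finset ((Σ v, Fin (t v)) × Fin k)) := by
  ext ⟨⟨v, i⟩, j⟩
  simp [weightPoint]

theorem ncard_weightPoint_preimage (t : W → ℕ) (k : ℕ) (A : Finset W) :
    (weightPoint t k ⁻¹' (A : Set W)).ncard = k * ∑ v ∈ A, t v := by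
  rw [weightPoint_preimage, Set.ncard_coe_finset, Finset.card_product, Finset.card_sigma]
  simp [mul_comm]

theorem finite_weightPoint_preimage (t : W → ℕ) (k : ℕ) (y : W) :
    (weightPoint t k ⁻¹' {y}).Finite := by
  have := weightPoint_preimage t k {y}
  rw [Finset.coe_singleton] at this
  rw [this]
  exact Finset.finite_toSet _

theorem IsWeight.isCoarselyDense {Y : SimpleGraph W} {n : ℕ} {t : W → ℕ} (ht : IsWeight Y n t)
    {k : ℕ} (hk : 0 < k) : IsCoarselyDense Y (weightPoint t k) := by
  obtain ⟨K, hK⟩ := ht.1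
  refine ⟨K, fun y => ?_⟩
  obtain ⟨v, hv, hd⟩ := hK y
  exact ⟨(⟨v, ⟨0, hv⟩⟩, ⟨0, hk⟩), hd⟩

/-- A quasi-`m/n`-to-one map is at bounded distance from a map respecting suitable partitions of
the source into `m`-sets and of the target into `n`-sets, both of bounded diameter. -/
theorem exists_block_equiv {X : Type*} {Y : SimpleGraph W} (hY : Y.Connected)
    (hball : HasBoundedBalls Y) {n m : ℕ} (hn : 0 < n) (hm : 0 < m) {t : W → ℕ}
    (ht : IsWeight Y n t) {f : X → W} (hf : ∀ y, (f ⁻¹' {y}).Finite) (hfK : IsCoarselyDense Y f)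
    {C : ℝ} (hC : ∀ A : Finset W, |(m : ℝ) / n * (A.card : ℝ) - ((f ⁻¹' (A : Set W)).ncard : ℝ)| ≤
      C * ((vertexBoundary Y (A : Set W)).ncard : ℝ)) :
    ∃ (R : ℕ) (e : X ≃ (Σ v, Fin (t v)) × Fin m) (e' : W ≃ (Σ v, Fin (t v)) × Fin n),
      ∀ x w, (e x).1 = (e' w).1 → Y.dist (f x) w ≤ R := by
  have hn' : (0 : ℝ) < n := Nat.cast_pos.2 hn
  obtain ⟨C', hC'⟩ := ht.2
  obtain ⟨R₁, e, he⟩ := exists_equiv_dist_le hY hball hf (finite_weightPoint_preimage t m) hfK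
    (ht.isCoarselyDense hm) (C := C + m / n * C') fun A => by
      rw [ncard_weightPoint_preimage, Nat.cast_mul]
      have h1 := hC A
      have h2 := mul_le_mul_of_nonneg_left (hC' A) (show (0 : ℝ) ≤ m / n by positivity)
      rw [← abs_of_nonneg (show (0 : ℝ) ≤ m / n by positivity), ← abs_mul,
        abs_of_nonneg (show (0 : ℝ) ≤ m / n by positivity), mul_sub, ← mul_assoc,
        div_mul_cancel₀ _ hn'.ne'] at h2
      rw [abs_le] at h1 h2 ⊢
      constructor <;> linarith
  -- Matching the identity of W with the n-fold points cuts W itself into n-blocks, indexed as the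
  -- m-blocks of X are.
  obtain ⟨R₂, e', he'⟩ := exists_equiv_dist_le hY hball (f := (id : W → W))
    (fun y => by simp) (finite_weightPoint_preimage t n)
    ⟨0, fun y => ⟨y, by simp⟩⟩ (ht.isCoarselyDense hn) (C := C') fun A => by
      rw [ncard_weightPoint_preimage, Nat.cast_mul, Set.preimage_id, Set.ncard_coe_finset,
        abs_sub_comm]
      exact hC' A
  refine ⟨R₁ + R₂, e, e', fun x w h => ?_⟩
  have h1 := he x
  have h2 := he' w
  rw [weightPoint] at h1 h2
  rw [← h, SimpleGraph.dist_comm] at h2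
  exact hY.dist_triangle.trans (add_le_add h1 h2)

end Weight

/-! ### Blockwise maps between colourings. -/

section Blocks

variable {N M G H I : Type*} [Group N] [Group M] {m n : ℕ}

/-- The colouring of the blocks of `H` obtained by applying `σ` to the colouring of the blocks of
`G`. -/
def blockMap (e : G ≃ I × Fin m) (e' : H ≃ I × Fin n) (σ : (Fin m → N) → (Fin n → M))
    (hσ : σ 1 = 1) (c : Colouring N G) : Colouring M H :=
  ⟨fun h => σ (fun k => c.1 (e.symm ((e' h).1, k))) (e' h).2, by
    have hc : (Function.mulSupport c.1).Finite := c.2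
    refine (((hc.image fun p => (e p).1).prod (Set.finite_univ (α := Fin n))).preimage
      e'.injective.injOn).subset ?_
    intro h hh
    refine ⟨?_, Set.mem_univ _⟩
    by_contra hcon
    refine hh ?_
    have : (fun k => c.1 (e.symm ((e' h).1, k))) = 1 := by
      funext k
      by_contra hk
      exact hcon ⟨_, hk, by simp⟩
    simp only [this, hσ, Pi.one_apply]⟩

theorem blockMap_blockMap (e : G ≃ I × Fin m) (e' : H ≃ I × Fin n)
    (σ : (Fin m → N) ≃ (Fin n → M)) (hσ : σ 1 = 1) (hσ' : σ.symm 1 = 1) (c : Colouring N G) :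
    blockMap e' e σ.symm hσ' (blockMap e e' σ hσ c) = c := by
  ext p
  simp [blockMap]

theorem blockMap_blockMap_symm (e : G ≃ I × Fin m) (e' : H ≃ I × Fin n)
    (σ : (Fin m → N) ≃ (Fin n → M)) (hσ : σ 1 = 1) (hσ' : σ.symm 1 = 1) (c : Colouring M H) :
    blockMap e e' σ hσ (blockMap e' e σ.symm hσ' c) = c := by
  ext h
  simp [blockMap]

theorem finite_colouring (E : Set H) (hE : E.Finite) (F : Set M) (hF : F.Finite) :
    {c : Colouring M H | ∀ z, c.1 z ≠ 1 → z ∈ E ∧ c.1 z ∈ F}.Finite := by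
  have : Finite E := hE
  have : Finite (insert 1 F : Set M) := hF.insert 1
  have hmem : ∀ c : {c : Colouring M H | ∀ z, c.1 z ≠ 1 → z ∈ E ∧ c.1 z ∈ F}, ∀ z,
      c.1.1 z ∈ (insert 1 F : Set M) := fun c z => by
    by_cases h : c.1.1 z = 1
    · exact Or.inl h
    · exact Or.inr (c.2 z h).2
  have : Finite {c : Colouring M H | ∀ z, c.1 z ≠ 1 → z ∈ E ∧ c.1 z ∈ F} := by
    refine Finite.of_injective (fun c (z : E) =>
      (⟨c.1.1 z, hmem c z⟩ : (insert 1 F : Set M))) fun c d hcd => ?_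
    ext z
    by_cases hz : z ∈ E
    · exact congrArg Subtype.val (congrFun hcd ⟨z, hz⟩)
    · rw [not_imp_comm.1 (fun h => (c.2 z h).1) hz, not_imp_comm.1 (fun h => (d.2 z h).1) hz]
  exact Set.toFinite _

theorem inv_mul_left_apply [Group H] (c d : Colouring M H) (h h' z : H) :
    ((⟨c, h⟩ : Wreath M H)⁻¹ * ⟨d, h'⟩).left.1 z = (c.1 (h * z))⁻¹ * d.1 (h * z) := by
  change (c.1 ((h⁻¹)⁻¹ * z))⁻¹ * d.1 ((h⁻¹)⁻¹ * z) = _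
  rw [inv_inv]

/-- Recolouring one point changes one argument of σ in one coordinate, so the new colouring differs
only on the matching block, which `hE` keeps near the cursor, and `hσc` leaves finitely many
possible changes of colour. -/
theorem isControlled_blockMap [Group G] [Group H] (e : G ≃ I × Fin m) (e' : H ≃ I × Fin n)
    (σ : (Fin m → N) → (Fin n → M)) (hσ : σ 1 = 1) (hσc : IsControlled σ) {β : G → H}
    (hβ : IsControlled β) (hE : {x : H | ∃ p h, (e p).1 = (e' h).1 ∧ (β p)⁻¹ * h = x}.Finite) :
    IsControlled fun w : Wreath N G => (⟨blockMap e e' σ hσ w.left, β w.right⟩ : Wreath M H) := by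
  classical
  refine isControlled_of_closure
    (closure_standard_generators (T := Set.univ) (S := Set.univ) (by simp) (by simp)) ?_
  rintro _ (⟨a, -, rfl⟩ | ⟨s, -, rfl⟩)
  · -- changing the colour at one point
    -- All coordinates of the changes of σ when one of its entries is multiplied by a.
    set F : Set M := ⋃ k : Fin m, (⋃ j : Fin n, (fun y : Fin n → M => y j) ''
      (Set.range fun x : Fin m → N => (σ x)⁻¹ * σ (x * Pi.mulSingle k a)))
    have hF : F.Finite := Set.finite_iUnion fun k => Set.finite_iUnion fun j => (hσc _).image _
    refine ((finite_colouring _ hE F hF).image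
      (SemidirectProduct.inl : Colouring M H →* Wreath M H)).subset ?_
    rintro _ ⟨⟨c, p⟩, rfl⟩
    refine ⟨((⟨blockMap e e' σ hσ c, β p⟩ : Wreath M H)⁻¹ *
      ⟨blockMap e e' σ hσ (c * colouringAction N G p (Colouring.single 1 a)), β p⟩).left, ?_, ?_⟩
    · intro z hz
      have hval : ((⟨blockMap e e' σ hσ c, β p⟩ : Wreath M H)⁻¹ *
          ⟨blockMap e e' σ hσ (c * colouringAction N G p (Colouring.single 1 a)), β p⟩).left.1 z =
          ((blockMap e e' σ hσ c).1 (β p * z))⁻¹ *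
          (blockMap e e' σ hσ (c * colouringAction N G p (Colouring.single 1 a))).1 (β p * z) :=
        inv_mul_left_apply _ _ _ _ _
      rw [hval] at hz ⊢
      set h := β p * z with hh
      have hcol : ∀ k, (c * colouringAction N G p (Colouring.single 1 a)).1
          (e.symm ((e' h).1, k)) = c.1 (e.symm ((e' h).1, k)) *
            (if e.symm ((e' h).1, k) = p then a else 1) := by
        intro k
        simp [colouringAction, Colouring.single, Pi.mulSingle_apply, inv_mul_eq_one, eq_comm]
      by_cases hblock : (e p).1 = (e' h).1
      · refine ⟨⟨p, h, hblock, by simp [hh]⟩, ?_⟩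
        refine Set.mem_iUnion.2 ⟨(e p).2, Set.mem_iUnion.2 ⟨(e' h).2, _,
          ⟨fun k => c.1 (e.symm ((e' h).1, k)), rfl⟩, ?_⟩⟩
        have : (fun k => (c * colouringAction N G p (Colouring.single 1 a)).1
            (e.symm ((e' h).1, k))) = (fun k => c.1 (e.symm ((e' h).1, k))) *
              Pi.mulSingle (e p).2 a := by
          funext k
          rw [hcol, Pi.mul_apply, Pi.mulSingle_apply, Equiv.symm_apply_eq]
          congr 1
          simp [Prod.ext_iff, ← hblock]
        simp only [blockMap, this, Pi.mul_apply, Pi.inv_apply]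
      · refine absurd ?_ hz
        have : (fun k => (c * colouringAction N G p (Colouring.single 1 a)).1
            (e.symm ((e' h).1, k))) = fun k => c.1 (e.symm ((e' h).1, k)) := by
          funext k
          rw [hcol, if_neg, mul_one]
          intro hp
          rw [Equiv.symm_apply_eq] at hp
          exact hblock (by rw [← hp])
        simp only [blockMap, this, inv_mul_cancel]
    · ext
      · simp
      · simp
  · -- moving
    refine ((hβ s).image (SemidirectProduct.inr : H →* Wreath M H)).subset ?_
    rintro _ ⟨⟨c, p⟩, rfl⟩
    refine ⟨_, ⟨p, rfl⟩, ?_⟩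
    ext
    · simp
    · simp

end Blocks

/-! ### Consequences of the metric hypotheses on Cayley graphs. -/

section QuasiIsometry

open SimpleGraph

variable {G H : Type*} [Group G] [Group H]

theorem hasBoundedBalls_mulCayley {S : Set G} (hS : IsFiniteGeneratingSet S) :
    HasBoundedBalls (mulCayley S) := by
  refine fun r => ⟨{g : G | (mulCayley S).dist 1 g ≤ r}.ncard, fun x => ?_⟩
  rw [ball_eq_image hS.2]
  exact ⟨(finite_ball_one hS r).image _, Set.ncard_image_le (finite_ball_one hS r)⟩

theorem IsQuasiIsometry.exists_dist_le {S : Set G} {T : Set H} {f : G → H}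
    (hf : IsQuasiIsometry (mulCayley S) (mulCayley T) f) (r : ℕ) :
    ∃ R : ℕ, ∀ p p', (mulCayley T).dist (f p) (f p') ≤ r → (mulCayley S).dist p p' ≤ R := by
  obtain ⟨C, K, hC, hK, h, -⟩ := hf
  refine ⟨⌈C * (r + K)⌉₊, fun p p' hp => ?_⟩
  have h1 := (h p p').1
  have h2 : ((mulCayley T).dist (f p) (f p') : ℝ) ≤ r := by exact_mod_cast hp
  have h3 : 1 / C * ((mulCayley S).dist p p' : ℝ) ≤ r + K := by linarith
  rw [one_div, inv_mul_le_iff₀ (by linarith)] at h3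
  exact_mod_cast h3.trans (Nat.le_ceil _)

theorem IsQuasiIsometry.isControlled {S : Set G} {T : Set H} {f : G → H}
    (hf : IsQuasiIsometry (mulCayley S) (mulCayley T) f) (hS : IsFiniteGeneratingSet S)
    (hT : IsFiniteGeneratingSet T) : IsControlled f := by
  obtain ⟨C, K, hC, hK, h, -⟩ := hf
  exact isControlled_of_dist hS hT fun w w' => (h w w').2

theorem IsQuasiIsometry.isCoarselyDense {S : Set G} {T : Set H} {f : G → H}
    (hf : IsQuasiIsometry (mulCayley S) (mulCayley T) f) : IsCoarselyDense (mulCayley T) f := by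
  obtain ⟨C, K, hC, hK, -, h⟩ := hf
  refine ⟨⌈K⌉₊, fun y => (h y).imp fun x hx => ?_⟩
  exact_mod_cast hx.trans (Nat.le_ceil _)

theorem IsQuasiIsometry.finite_fibre {S : Set G} {T : Set H} {f : G → H}
    (hf : IsQuasiIsometry (mulCayley S) (mulCayley T) f) (hS : IsFiniteGeneratingSet S) (y : H) :
    (f ⁻¹' {y}).Finite := by
  obtain ⟨R, hR⟩ := hf.exists_dist_le 0
  rcases (f ⁻¹' {y}).eq_empty_or_nonempty with h | ⟨p, hp⟩
  · simp [h]
  · obtain ⟨b, hb⟩ := hasBoundedBalls_mulCayley hS R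
    refine (hb p).1.subset fun p' hp' => hR p p' ?_
    rw [Set.mem_preimage, Set.mem_singleton_iff] at hp hp'
    rw [hp, hp', dist_self]

/-- Images under f of g(h) and g(ht) are close because h and ht are, and the lower quasi-isometry
bound pulls this back to G. -/
theorem isControlled_of_rightInverse {S : Set G} {T : Set H} {f : G → H}
    (hf : IsQuasiIsometry (mulCayley S) (mulCayley T) f) (hS : IsFiniteGeneratingSet S)
    (hT : IsFiniteGeneratingSet T) {g : H → G} {K : ℕ}
    (hg : ∀ h, (mulCayley T).dist h (f (g h)) ≤ K) : IsControlled g := by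
  intro t
  obtain ⟨R, hR⟩ := hf.exists_dist_le (K + ((mulCayley T).dist 1 t + K))
  refine finite_range_of_dist_le hS (r := R) fun h => hR _ _ ?_
  refine ((mulCayley_connected hT.2).dist_triangle (v := h)).trans (add_le_add ?_ ?_)
  · rw [dist_comm]; exact hg h
  · refine ((mulCayley_connected hT.2).dist_triangle (v := h * t)).trans (add_le_add ?_ (hg _))
    rw [mulCayley_dist_eq hT.2, inv_mul_cancel_left]

/-- A biLipschitz equivalence can be normalised to a bijection fixing the identity which is
controlled, as is its inverse. -/
theorem IsBiLipschitzEquivalence.exists_equiv {S : Set G} {T : Set H} {σ : G → H}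
    (hσ : IsBiLipschitzEquivalence (mulCayley S) (mulCayley T) σ) (hS : IsFiniteGeneratingSet S)
    (hT : IsFiniteGeneratingSet T) :
    ∃ τ : G ≃ H, τ 1 = 1 ∧ IsControlled τ ∧ IsControlled τ.symm := by
  have hqi : IsQuasiIsometry (mulCayley S) (mulCayley T) σ := by
    obtain ⟨C, hC, h⟩ := hσ
    exact ⟨C, 0, hC, le_rfl, h⟩
  obtain ⟨C, hC, h, hsurj⟩ := hσ
  have hbij : Function.Bijective σ := by
    refine ⟨fun x y hxy => ?_, fun y => ?_⟩
    · have h1 := (h x y).1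
      rw [hxy, dist_self, Nat.cast_zero, sub_zero, one_div, inv_mul_le_iff₀ (by linarith),
        mul_zero] at h1
      exact (mulCayley_connected hS.2).dist_eq_zero_iff.1
        (Nat.le_zero.1 (by exact_mod_cast h1))
    · obtain ⟨x, hx⟩ := hsurj y
      exact ⟨x, ((mulCayley_connected hT.2).dist_eq_zero_iff.1
        (Nat.le_zero.1 (by exact_mod_cast hx))).symm⟩
  set e := Equiv.ofBijective σ hbij
  have he : IsControlled e := hqi.isControlled hS hT
  have he' : IsControlled e.symm := isControlled_of_rightInverse hqi hS hT (K := 0) fun y => by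
    have : σ (e.symm y) = y := e.apply_symm_apply y
    rw [this, dist_self]
  -- Left translation moves the image of 1 to 1 and cancels in every displacement.
  refine ⟨e.trans (Equiv.mulLeft (e 1)⁻¹), by simp, fun g => (he g).subset ?_,
    fun g => (he' g).subset ?_⟩
  · rintro _ ⟨w, rfl⟩
    exact ⟨w, by simp [mul_assoc]⟩
  · rintro _ ⟨w, rfl⟩
    exact ⟨e 1 * w, by simp [mul_assoc]⟩

/-- For finite H the whole of H has empty boundary, so the counting is exact: m|H| = n|G|.
Divisibility of |G| by m then gives n ∣ |H|. -/
theorem exists_isWeight {S : Set G} {T : Set H} (hT : IsFiniteGeneratingSet T) {n m : ℕ}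
    (hn : 0 < n) (hm : 0 < m) (hG : Finite G → m ∣ Nat.card G) {f : G → H}
    (hf : IsQuasiToOne ((m : ℝ) / n) (mulCayley S) (mulCayley T) f) :
    ∃ t : H → ℕ, IsWeight (mulCayley T) n t := by
  rcases finite_or_infinite H with hH | hH
  · have : Fintype H := Fintype.ofFinite H
    have hn' : (0 : ℝ) < n := Nat.cast_pos.2 hn
    obtain ⟨-, -, C, -, hC⟩ := hf
    have h := hC Finset.univ
    have hb : vertexBoundary (mulCayley T) (Set.univ : Set H) = ∅ := by
      ext y
      simp [vertexBoundary]
    rw [Finset.coe_univ, hb, Set.ncard_empty, Nat.cast_zero, mul_zero, abs_nonpos_iff,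
      Set.preimage_univ, Set.ncard_univ, Finset.card_univ, ← Nat.card_eq_fintype_card, sub_eq_zero,
      div_mul_eq_mul_div, div_eq_iff hn'.ne'] at h
    have h' : m * Nat.card H = Nat.card G * n := by exact_mod_cast h
    -- `Nat.card` vanishes on infinite types, so this also yields finiteness of G.
    have hpos : Nat.card G ≠ 0 := by
      intro h0
      rw [h0, zero_mul, mul_eq_zero] at h'
      rcases h' with h' | h'
      · omega
      · exact Nat.card_pos.ne' h'
    obtain ⟨k, hk⟩ := hG (Nat.finite_of_card_ne_zero hpos)
    refine exists_isWeight_of_finite (k := k) (mulCayley_connected hT.2) ?_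
    rw [hk] at h'
    exact Nat.eq_of_mul_eq_mul_left hm (by linarith)
  · exact exists_isWeight_of_infinite (mulCayley_connected hT.2) (hasBoundedBalls_mulCayley hT) hn

end QuasiIsometry

/-- Since the colouring is recovered exactly, the only error is in the cursor. -/
theorem finite_range_inv_mul_of_eq_mk {N G : Type*} [Group N] [Group G]
    {ρ : Wreath N G → Wreath N G} {γ : G → G} (hρ : ∀ c p, ρ ⟨c, p⟩ = ⟨c, γ p⟩)
    (hγ : (Set.range fun p => (γ p)⁻¹ * p).Finite) :
    (Set.range fun w => (ρ w)⁻¹ * w).Finite := by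
  refine (hγ.image (SemidirectProduct.inr : G →* Wreath N G)).subset ?_
  rintro _ ⟨⟨c, p⟩, rfl⟩
  refine ⟨_, ⟨p, rfl⟩, ?_⟩
  simp only [hρ]
  ext <;> simp

end CoarseWreath

/-! ### Assembly of the aptolic quasi-isometry and its quasi-inverse. -/

theorem mainTheorem10
    {N M G H : Type*} [Group N] [Group M] [Group G] [Group H]
    [Group.FG N] [Group.FG M] [Group.FG G] [Group.FG H]
    (n m : ℕ) (hn : 2 ≤ n) (hm : 2 ≤ m)
    (hG : Finite G → m ∣ Nat.card G)
    (A : Set (Fin m → N)) (hA : IsFiniteGeneratingSet A)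
    (B : Set (Fin n → M)) (hB : IsFiniteGeneratingSet B)
    (S : Set G) (hS : IsFiniteGeneratingSet S)
    (T : Set H) (hT : IsFiniteGeneratingSet T)
    (U : Set (Wreath N G)) (hU : IsFiniteGeneratingSet U)
    (V : Set (Wreath M H)) (hV : IsFiniteGeneratingSet V)
    (hNM : ∃ σ : (Fin m → N) → (Fin n → M),
      IsBiLipschitzEquivalence (SimpleGraph.mulCayley A) (SimpleGraph.mulCayley B) σ)
    (hGH : ∃ f : G → H, IsQuasiToOne ((m : ℝ) / (n : ℝ)) (SimpleGraph.mulCayley S) (SimpleGraph.mulCayley T) f) :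
    ∃ q : Wreath N G → Wreath M H, IsAptolicQuasiIsometry (SimpleGraph.mulCayley U) (SimpleGraph.mulCayley V) q := by
  obtain ⟨σ₀, hσ₀⟩ := hNM
  obtain ⟨f, hf⟩ := hGH
  obtain ⟨σ, hσ, hσc, hσc'⟩ := hσ₀.exists_equiv hA hB
  have hσ' : σ.symm 1 = 1 := by rw [Equiv.symm_apply_eq, hσ]
  obtain ⟨t, ht⟩ := exists_isWeight hT (by omega) (by omega) hG hf
  obtain ⟨hqi, -, C, -, hC⟩ := hf
  obtain ⟨R, e, e', hR⟩ := exists_block_equiv (mulCayley_connected hT.2)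
    (hasBoundedBalls_mulCayley hT) (by omega) (by omega) ht (hqi.finite_fibre hS)
    hqi.isCoarselyDense hC
  obtain ⟨K, hK⟩ := hqi.isCoarselyDense
  choose g hg using hK
  have hfc := hqi.isControlled hS hT
  have hgc := isControlled_of_rightInverse hqi hS hT hg
  have hT' := mulCayley_connected hT.2
  have hfg : (Set.range fun h => (f (g h))⁻¹ * h).Finite :=
    finite_range_of_dist_le hT (r := K) fun h => by
      rw [SimpleGraph.dist_comm]
      exact hg h
  have hgf : (Set.range fun p => (g (f p))⁻¹ * p).Finite := by
    obtain ⟨R', hR'⟩ := hqi.exists_dist_le K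
    refine finite_range_of_dist_le hS (r := R') fun p => hR' _ _ ?_
    rw [SimpleGraph.dist_comm]
    exact hg _
  obtain ⟨q, hq⟩ : ∃ q : Wreath N G → Wreath M H,
      q = fun w => ⟨blockMap e e' σ hσ w.left, f w.right⟩ := ⟨_, rfl⟩
  obtain ⟨r, hr⟩ : ∃ r : Wreath M H → Wreath N G,
      r = fun w => ⟨blockMap e' e σ.symm hσ' w.left, g w.right⟩ := ⟨_, rfl⟩
  have hqc : IsControlled q := by
    rw [hq]
    refine isControlled_blockMap e e' σ hσ hσc hfc ((finite_ball_one hT R).subset ?_)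
    rintro _ ⟨p, h, hph, rfl⟩
    rw [Set.mem_ofPred_eq, ← mulCayley_dist_eq hT.2]
    exact hR p h hph
  have hrc : IsControlled r := by
    -- For h and p in matching blocks, f(g(h)) is within K of h and f(p) within R of h, which bounds
    -- the distance from g(h) to p.
    obtain ⟨R', hR'⟩ := hqi.exists_dist_le (K + R)
    rw [hr]
    refine isControlled_blockMap e' e σ.symm hσ' hσc' hgc ((finite_ball_one hS R').subset ?_)
    rintro _ ⟨h, p, hph, rfl⟩
    rw [Set.mem_ofPred_eq, ← mulCayley_dist_eq hS.2]
    refine hR' _ _ ((hT'.dist_triangle (v := h)).trans (add_le_add ?_ ?_))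
    · rw [SimpleGraph.dist_comm]
      exact hg h
    · rw [SimpleGraph.dist_comm]
      exact hR p h hph.symm
  have hrq : (Set.range fun w => (r (q w))⁻¹ * w).Finite :=
    finite_range_inv_mul_of_eq_mk (ρ := fun w => r (q w)) (γ := fun p => g (f p))
      (fun c p => by simp only [hq, hr, blockMap_blockMap]) hgf
  have hqr : (Set.range fun w => (q (r w))⁻¹ * w).Finite :=
    finite_range_inv_mul_of_eq_mk (ρ := fun w => q (r w)) (γ := fun h => f (g h))
      (fun c p => by simp only [hq, hr, blockMap_blockMap_symm]) hfg
  exact ⟨q, hqc.isQuasiIsometry hrc hrq hqr hU hV,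
    ⟨blockMap e e' σ hσ, f, fun c p => by rw [hq]⟩, r,
    hrc.isQuasiIsometry hqc hqr hrq hV hU, isQuasiInverse_of_finite hrq hqr hU hV,
    ⟨blockMap e' e σ.symm hσ', g, fun c p => by rw [hr]⟩⟩
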